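/- Throughout, $\log$ is the natural logarithm. For a finite graph $F$ let $Z_F(\lambda)=\sum_{I}\lambda^{|I|}$, the sum being over all independent sets $I$ of $F$ (including $\varnothing$), be the partition function of the hard-core model on $F$ at fugacity $\lambda$. Given $\lambda,\beta,\gamma>0$, the hard-core model on a finite graph $G$ at fugacity $\lambda$ has local $(\beta,\gamma)$-occupancy if, for every vertex $u$ and every (possibly empty) induced subgraph $F$ of the subgraph $G[N(u)]$ induced by the neighbourhood of $u$, \[ \beta\,\frac{\lambda}{1+\lambda}\,\frac{1}{Z_F(\lambda)}+\gamma\,\frac{\lambda Z_F'(\lambda)}{Z_F(\lambda)}\ \ge\ 1 . \] Given lists $\hat L(v)\subset\mathbb{N}$, $v\in V(G)$, the cover graph of $(G,\hat L)$ has vertex set $\{(v,i): v\in V(G),\ i\in\hat L(v)\}$; for each $v$ the pairs with first entry $v$ form a clique, and $(v,i)$ and $(w,i)$ are adjacent for each edge $vw$ of $G$ and each $i\in\hat L(v)\cap\hat L(w)$. The graph $G$ is $q$-choosable if for all lists with $|\hat L(v)|=q$ for every $v$ there is a proper colouring $f$ of $G$ with $f(v)\in\hat L(v)$ for every $v$,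 and $\chi_\ell(G)$ is the least such $q$. \textbf{Theorem (Chromatic number via local occupancy).} Let $G$ be a finite graph of maximum degree $\Delta$, let $\lambda,\beta,\gamma>0$, and suppose that the hard-core model on $G$ at fugacity $\lambda$ has local $(\beta,\gamma)$-occupancy. Let $q\ge 1$ be an integer, and suppose that for some integer $d\ge \frac{2}{e}\log(2e\Delta^3)$ we have \[ \frac{1+\lambda}{\beta\lambda}\,(q-\gamma\Delta)\ \ge\ 4ed \] and \[ \frac{1}{Z_F(\lambda)}\ \le\ \frac{1}{2eq\Delta^3}\qquad\text{for every } u\in V(G) \text{ and every subgraph } F \text{ of } G[N(u)] \text{ with exactly } d \text{ vertices.} \] (If $\Delta=0$, these expressions are read with the conventions $\log 0=0$ and $1/0=0$.) Then $\chi(G)\le q$. Moreover $\chi_\ell(G)\le q$, and for all lists with $|\hat L(v)|=q$ for every $v\in V(G)$, the cover graph of $(G,\hat L)$ has an independent set of size $|V(G)|$. -/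

import Mathlib

namespace LocalOccupancy

/-- The partition function `Z_F(x) = ∑_{I ∈ 𝓘(F)} x ^ |I|` of the hard-core model on a finite graph
`F` at fugacity `x`; the sum is over all independent sets of `F`, including the empty one. -/
noncomputable def partitionFunction {W : Type*} [Finite W] (F : SimpleGraph W) (x : ℝ) : ℝ :=
  ∑ I ∈ (Set.toFinite {I : Finset W | F.IsIndepSet (I : Set W)}).toFinset, x ^ I.card

/-- The hard-core model on `G` at fugacity `lam` has local `(β, γ)`-occupancy: for every vertex `u`
and every induced subgraph `F` of `G[N(u)]` (the one with no vertices included),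
`β * (lam / (1 + lam)) * (1 / Z_F(lam)) + γ * (lam * Z_F'(lam) / Z_F(lam)) ≥ 1`. -/
def HasLocalOccupancy {V : Type*} [Finite V] (G : SimpleGraph V) (lam β γ : ℝ) : Prop :=
  ∀ u : V, ∀ A : Set V, A ⊆ G.neighborSet u →
    1 ≤ β * (lam / (1 + lam)) * (1 / partitionFunction (G.induce A) lam) +
      γ * (lam * deriv (partitionFunction (G.induce A)) lam / partitionFunction (G.induce A) lam)

/-- `G` is `q`-choosable: for every assignment of lists of exactly `q` natural numbers to the
vertices there is a proper colouring in which each vertex gets a colour from its own list. -/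
def Choosable {V : Type*} (G : SimpleGraph V) (q : ℕ) : Prop :=
  ∀ L : V → Finset ℕ, (∀ v, (L v).card = q) → ∃ f : G.Coloring ℕ, ∀ v, f v ∈ L v

/-- The list chromatic number: the least `q` for which `G` is `q`-choosable. -/
noncomputable def listChromaticNumber {V : Type*} (G : SimpleGraph V) : ℕ∞ :=
  ⨅ q ∈ {q : ℕ | Choosable G q}, (q : ℕ∞)

/-- The cover graph `H` of `G` for the list assignment `L`: its vertices are the pairs `(u, i)` with
`i ∈ L u`; each `L u` spans a clique, and `(u, i)` and `(v, i)` are adjacent for each edge `uv`. -/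
def coverGraph {V : Type*} (G : SimpleGraph V) (L : V → Finset ℕ) :
    SimpleGraph {x : V × ℕ // x.2 ∈ L x.1} where
  Adj x y := (x.1.1 = y.1.1 ∧ x.1.2 ≠ y.1.2) ∨ (G.Adj x.1.1 y.1.1 ∧ x.1.2 = y.1.2)
  symm := ⟨by
    rintro x y (⟨h, h'⟩ | ⟨h, h'⟩)
    · exact Or.inl ⟨h.symm, h'.symm⟩
    · exact Or.inr ⟨h.symm, h'.symm⟩⟩
  loopless := ⟨by
    rintro x (⟨_, h⟩ | ⟨h, _⟩)
    · exact h rfl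
    · exact G.loopless.irrefl _ h⟩

end LocalOccupancy

/-!
A random partial colouring `c` from the lists is drawn with probability proportional to
`lam ^ (number of coloured vertices)`, that is, an independent set of the cover graph is drawn from
the hard-core model. A vertex is bad (`IsBad`) if it has fewer than `4 * d` available colours, or if
some available colour is also free at `d` or more of its uncoloured neighbours. If no vertex is bad,
the colouring extends to the uncoloured vertices: the lists of available colours are then four times
larger than the colour degrees, and a count of partial extensions shows that list colouring
succeeds (`exists_list_coloring_of_colorDegree`).

That all bad vertices can be avoided is shown by the lopsided local lemma
(`exists_avoiding_of_lopsided`), for which it is enough to bound the probability that `v` is bad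
conditionally on everything but the colours of the neighbours of `v`. Events of this conditioning
are encoded as sets of partial colourings that are closed under changes around `v`
(`IsLocalClass`). Resampling a single colour `i` around `v` (`IsLocalClass.sum_eq`) amounts to
choosing an independent set from the hard-core model on the set of neighbours of `v` that are free
for `i`, so:

* the colour `i` is available at `v` while `d` neighbours are free for it with probability at most
  the largest `1 / Z_F` over `F` with `d` vertices (`IsLocalClass.sum_freeNeighbors_le`);
* the number `X` of available colours at `v` has the lower tail of a Poisson variable of mean
  `4 * e * d`. Colours at `v` are not independent, nor negatively correlated in general. Instead,
  local occupancy is applied under the tilted weight `s ^ X`, which only strengthens it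
  (`IsLocalClass.sum_pow_le`). The neighbours of `v` carry at most `Δ` colours in total, under any
  weight, so that summing over `i` gives the differential inequality `M' ≥ 4 * e * d * M` for the
  generating function `M s = E [s ^ X]` on `[0, 1]`; hence
  `M (1 / 2) ≤ exp (-2 * e * d) * M 1` (`IsLocalClass.sum_half_pow_le`).

Badness of `v` and of `w` interact only within distance three, which leaves at most `Δ ^ 3` vertices
when `2 ≤ Δ`. When `Δ ≤ 1` the lists themselves are large enough for the final extension step.
-/

namespace LocalOccupancy

open Finset
open scoped Classical

/-! ### The lopsided local lemma -/

/-- The symmetric lopsided local lemma for a finite weighted space. -/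
theorem exists_avoiding_of_lopsided {Ω ι : Type*} [Fintype ι] (s : Finset Ω) (w : Ω → ℝ)
    (hw : ∀ c ∈ s, 0 ≤ w c) (hs : 0 < ∑ c ∈ s, w c) (B : ι → Ω → Prop) (Γ : ι → Finset ι)
    (p x : ℝ) (n : ℕ) (hx0 : 0 ≤ x) (hx : x < 1) (hp : p ≤ x * (1 - x) ^ n)
    (hself : ∀ v, v ∈ Γ v) (hcard : ∀ v, (Γ v).card ≤ n + 1)
    (h : ∀ v, ∀ T : Finset ι, Disjoint T (Γ v) →
      ∑ c ∈ s with (∀ t ∈ T, ¬ B t c) ∧ B v c, w c ≤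
        p * ∑ c ∈ s with ∀ t ∈ T, ¬ B t c, w c) :
    ∃ c ∈ s, ∀ v, ¬ B v c := by
  set W : Finset ι → ℝ := fun T => ∑ c ∈ s with ∀ t ∈ T, ¬ B t c, w c with hW
  have hx' : 0 < 1 - x := by linarith
  have hW0 : ∀ T, 0 ≤ W T := fun T =>
    sum_nonneg fun c hc => hw c (mem_filter.1 hc).1
  have hsplit : ∀ T v, W (insert v T) = W T - ∑ c ∈ s with (∀ t ∈ T, ¬ B t c) ∧ B v c, w c := by
    intro T v
    have h1 := sum_filter_add_sum_filter_not (s.filter fun c => ∀ t ∈ T, ¬ B t c)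
      (fun c => B v c) w
    rw [filter_filter, filter_filter] at h1
    have h2 : W (insert v T) = ∑ c ∈ s with (∀ t ∈ T, ¬ B t c) ∧ ¬ B v c, w c := by
      simp only [hW]
      congr 1
      ext c
      simp only [mem_filter, forall_mem_insert]
      tauto
    simp only [hW] at h2 ⊢
    linarith
  -- Adding one more event to be avoided costs at most a factor `1 - x`.
  have key : ∀ k : ℕ, ∀ T : Finset ι, T.card = k → ∀ v, v ∉ T → (1 - x) * W T ≤ W (insert v T) := by
    intro k
    induction k using Nat.strong_induction_on with
    | _ k ih =>
      intro T hT v hv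
      -- Peeling off events of `T` one at a time.
      have peel : ∀ U : Finset ι, U ⊆ T → (1 - x) ^ U.card * W (T \ U) ≤ W T := by
        intro U
        induction U using Finset.induction_on with
        | empty => intro _; simp
        | insert a U ha ihU =>
          intro hU
          have haT : a ∈ T := hU (mem_insert_self _ _)
          have hUT : U ⊆ T := fun y hy => hU (mem_insert_of_mem hy)
          have hins : insert a (T \ insert a U) = T \ U := by
            ext y
            simp only [mem_insert, mem_sdiff]
            by_cases hy : y = a
            · subst hy; simp [haT, ha]
            · simp [hy]
          have hlt : (T \ insert a U).card < k := by
            rw [← hT]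
            exact card_lt_card ⟨sdiff_subset, fun hh => by
              have := hh haT
              simp at this⟩
          have h1 := ih _ hlt (T \ insert a U) rfl a (by simp)
          rw [hins] at h1
          rw [card_insert_of_notMem ha, pow_succ, mul_assoc]
          exact (mul_le_mul_of_nonneg_left h1 (pow_nonneg hx'.le _)).trans (ihU hUT)
      have h1 := peel (T ∩ Γ v) inter_subset_left
      have hc : (T ∩ Γ v).card ≤ n := by
        have : (T ∩ Γ v).card < (Γ v).card :=
          card_lt_card ⟨inter_subset_right, fun hh => hv (mem_inter.1 (hh (hself v))).1⟩
        have := hcard v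
        omega
      have hpow : (1 - x) ^ n ≤ (1 - x) ^ (T ∩ Γ v).card :=
        pow_le_pow_of_le_one hx'.le (by linarith) hc
      have h2 : (1 - x) ^ n * W (T \ (T ∩ Γ v)) ≤ W T :=
        (mul_le_mul_of_nonneg_right hpow (hW0 _)).trans h1
      have h3 := h v (T \ (T ∩ Γ v)) (by
        rw [Finset.disjoint_left]
        intro y hy hy'
        simp only [mem_sdiff, mem_inter, not_and] at hy
        exact hy.2 hy.1 hy')
      have h4 : ∑ c ∈ s with (∀ t ∈ T, ¬ B t c) ∧ B v c, w c ≤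
          ∑ c ∈ s with (∀ t ∈ T \ (T ∩ Γ v), ¬ B t c) ∧ B v c, w c := by
        apply sum_le_sum_of_subset_of_nonneg
        · intro c hc
          simp only [mem_filter] at hc ⊢
          exact ⟨hc.1, fun t ht => hc.2.1 t (mem_sdiff.1 ht).1, hc.2.2⟩
        · intro c hc _
          exact hw c (mem_filter.1 hc).1
      have h5 : p * W (T \ (T ∩ Γ v)) ≤ x * W T := by
        calc p * W (T \ (T ∩ Γ v)) ≤ x * (1 - x) ^ n * W (T \ (T ∩ Γ v)) :=
              mul_le_mul_of_nonneg_right hp (hW0 _)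
          _ = x * ((1 - x) ^ n * W (T \ (T ∩ Γ v))) := by ring
          _ ≤ x * W T := mul_le_mul_of_nonneg_left h2 hx0
      rw [hsplit]
      have h6 := h4.trans (h3.trans h5)
      linarith
  have pos : ∀ T : Finset ι, 0 < W T := by
    intro T
    induction T using Finset.induction_on with
    | empty => simpa [hW] using hs
    | insert a T ha ih => exact (mul_pos hx' ih).trans_le (key _ T rfl a ha)
  have hne : (s.filter fun c => ∀ t ∈ (univ : Finset ι), ¬ B t c).Nonempty := by
    by_contra hcon
    rw [not_nonempty_iff_eq_empty] at hcon
    have h1 := pos univ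
    simp only [hW, hcon, sum_empty, lt_irrefl] at h1
  obtain ⟨c, hc⟩ := hne
  exact ⟨c, (mem_filter.1 hc).1, fun v => (mem_filter.1 hc).2 v (mem_univ v)⟩

/-- The numerical condition of the symmetric local lemma, with `x = 1 / (n + 1)`. -/
theorem inv_exp_mul_le (n : ℕ) :
    1 / (Real.exp 1 * ((n : ℝ) + 1)) ≤ (1 / ((n : ℝ) + 1)) * (1 - 1 / ((n : ℝ) + 1)) ^ n := by
  have hn : (0 : ℝ) < (n : ℝ) + 1 := by positivity
  rcases Nat.eq_zero_or_pos n with rfl | hpos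
  · have := Real.one_lt_exp_iff.2 (zero_lt_one' ℝ)
    simp only [Nat.cast_zero, zero_add, mul_one, pow_zero, div_one]
    rw [div_le_one (Real.exp_pos 1)]
    exact this.le
  have hn' : (0 : ℝ) < n := by exact_mod_cast hpos
  have h1 : (1 : ℝ) - 1 / ((n : ℝ) + 1) = (1 + 1 / (n : ℝ))⁻¹ := by field_simp; ring
  have h2 : (1 + 1 / (n : ℝ)) ^ n ≤ Real.exp 1 := by
    have h3 : 1 + 1 / (n : ℝ) ≤ Real.exp (1 / (n : ℝ)) := by
      have := Real.add_one_le_exp (1 / (n : ℝ)); linarith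
    calc (1 + 1 / (n : ℝ)) ^ n ≤ Real.exp (1 / (n : ℝ)) ^ n := by gcongr
      _ = Real.exp 1 := by rw [← Real.exp_nat_mul]; congr 1; field_simp
  rw [h1, inv_pow, mul_comm (Real.exp 1), ← one_div_mul_one_div, ← one_div]
  gcongr

/-! ### List colouring with small colour degrees -/

/-- List colouring when every list is four times larger than all colour degrees. The colourings of
`S ⊆ U` are counted by induction on `S`: if each vertex at least multiplies the count by `l / 2`,
then at most `l * D * (2 / l) ≤ l / 2` extensions per colouring, on average, are blocked by a
neighbour. -/
theorem exists_list_coloring_of_colorDegree {V : Type*} [Fintype V] (G : SimpleGraph V)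
    (L : V → Finset ℕ) (U : Finset V) (l D : ℕ) (hl : 0 < l) (hlD : 4 * D ≤ l)
    (hL : ∀ v ∈ U, (L v).card = l)
    (hdeg : ∀ v ∈ U, ∀ i ∈ L v, (U.filter fun w => G.Adj v w ∧ i ∈ L w).card ≤ D) :
    ∃ f : V → ℕ, (∀ v ∈ U, f v ∈ L v) ∧ ∀ v ∈ U, ∀ w ∈ U, G.Adj v w → f v ≠ f w := by
  -- Proper colourings of `S` from the lists, set to `0` outside `S`.
  set C : Finset V → Finset (V → ℕ) := fun S =>
    (Fintype.piFinset fun v => if v ∈ S then L v else {0}).filter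
      fun f => ∀ v ∈ S, ∀ w ∈ S, G.Adj v w → f v ≠ f w with hC
  have memC : ∀ S f, f ∈ C S ↔ (∀ v ∈ S, f v ∈ L v) ∧ (∀ v, v ∉ S → f v = 0) ∧
      ∀ v ∈ S, ∀ w ∈ S, G.Adj v w → f v ≠ f w := by
    intro S f
    simp only [hC, mem_filter, Fintype.mem_piFinset, ← and_assoc]
    refine and_congr_left fun _ => ⟨fun hf => ⟨fun v hv => ?_, fun v hv => ?_⟩, fun hf v => ?_⟩
    · simpa [hv] using hf v
    · simpa [hv] using hf v
    · by_cases hv : v ∈ S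
      · simpa [hv] using hf.1 v hv
      · simpa [hv] using hf.2 v hv
  -- Colouring one more vertex multiplies the number of colourings by at least `l / 2`.
  have key : ∀ k : ℕ, ∀ S : Finset V, S.card = k → S ⊆ U → ∀ v ∈ U, v ∉ S →
      l * (C S).card ≤ 2 * (C (insert v S)).card := by
    intro k
    induction k using Nat.strong_induction_on with
    | _ k ih =>
      intro S hS hSU v hvU hv
      -- Colourings of `S` in which `w` has colour `i` restrict to colourings of `S \ {w}`.
      have hfix : ∀ w ∈ S, ∀ i, l * ((C S).filter fun f => f w = i).card ≤ 2 * (C S).card := by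
        intro w hw i
        have h1 : ((C S).filter fun f => f w = i).card ≤ (C (S.erase w)).card := by
          apply card_le_card_of_injOn (fun f => Function.update f w 0)
          · intro f hf
            simp only [coe_filter, Set.mem_ofPred_eq, memC] at hf
            rw [mem_coe, memC]
            refine ⟨fun y hy => ?_, fun y hy => ?_, fun y hy z hz hyz => ?_⟩
            · rw [mem_erase] at hy
              simpa [Function.update_of_ne hy.1] using hf.1.1 y hy.2
            · by_cases hyw : y = w
              · subst hyw; simp
              · exact (Function.update_of_ne hyw _ _).trans
                  (hf.1.2.1 y fun hh => hy (mem_erase.2 ⟨hyw, hh⟩))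
            · rw [mem_erase] at hy hz
              simpa [Function.update_of_ne hy.1, Function.update_of_ne hz.1] using
                hf.1.2.2 y hy.2 z hz.2 hyz
          · intro f hf g hg hfg
            simp only [coe_filter, Set.mem_ofPred_eq] at hf hg
            ext y
            by_cases hyw : y = w
            · rw [hyw, hf.2, hg.2]
            · have := congrFun hfg y
              simpa [Function.update_of_ne hyw] using this
        have h2 := ih (S.erase w).card (by rw [← hS]; exact card_erase_lt_of_mem hw)
          (S.erase w) rfl ((erase_subset _ _).trans hSU) w (hSU hw) (by simp)
        rw [insert_erase hw] at h2
        exact (Nat.mul_le_mul_left _ h1).trans h2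
      -- An extension of `f` by colour `i` at `v` is proper unless some neighbour blocks it.
      have hcover : (C S ×ˢ L v).card ≤ (C (insert v S)).card +
          ∑ i ∈ L v, ∑ w ∈ S with G.Adj v w ∧ i ∈ L w, ((C S).filter fun f => f w = i).card := by
        rw [← card_filter_add_card_filter_not (s := C S ×ˢ L v)
          (fun x => ∀ w ∈ S, G.Adj v w → x.1 w ≠ x.2)]
        apply Nat.add_le_add
        · apply card_le_card_of_injOn (fun x => Function.update x.1 v x.2)
          · rintro ⟨f, i⟩ hx
            simp only [coe_filter, mem_product, Set.mem_ofPred_eq, memC] at hx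
            obtain ⟨⟨⟨h1, h2, h3⟩, hi⟩, h4⟩ := hx
            rw [mem_coe, memC]
            have hne : ∀ y ∈ S, y ≠ v := fun y hy hyv => hv (hyv ▸ hy)
            refine ⟨fun y hy => ?_, fun y hy => ?_, fun y hy z hz hyz => ?_⟩
            · rcases mem_insert.1 hy with rfl | hy
              · simpa using hi
              · simpa [Function.update_of_ne (hne y hy)] using h1 y hy
            · simp only [mem_insert, not_or] at hy
              simpa [Function.update_of_ne hy.1] using h2 y hy.2
            · rcases mem_insert.1 hy with hyv | hyS <;> rcases mem_insert.1 hz with hzv | hzS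
              · exact absurd (hyv.trans hzv.symm) hyz.ne
              · subst hyv
                simpa [Function.update_of_ne (hne z hzS)] using (h4 z hzS hyz).symm
              · subst hzv
                simpa [Function.update_of_ne (hne y hyS)] using h4 y hyS hyz.symm
              · simpa [Function.update_of_ne (hne z hzS), Function.update_of_ne (hne y hyS)] using
                  h3 y hyS z hzS hyz
          · rintro ⟨f, i⟩ hx ⟨g, j⟩ hy hfg
            simp only [coe_filter, mem_product, Set.mem_ofPred_eq, memC] at hx hy
            have hij : i = j := by simpa using congrFun hfg v
            have hfg' : f = g := by
              ext y
              by_cases hyv : y = v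
              · rw [hyv, hx.1.1.2.1 v hv, hy.1.1.2.1 v hv]
              · simpa [Function.update_of_ne hyv] using congrFun hfg y
            rw [hij, hfg']
        · have hsub : ((C S ×ˢ L v).filter fun x => ¬ ∀ w ∈ S, G.Adj v w → x.1 w ≠ x.2) ⊆
              (L v).biUnion fun i => (S.filter fun w => G.Adj v w ∧ i ∈ L w).biUnion fun w =>
                ((C S).filter fun f => f w = i).image fun f => (f, i) := by
            rintro ⟨f, i⟩ hx
            simp only [mem_filter, mem_product, not_forall, not_not] at hx
            obtain ⟨⟨hf, hi⟩, w, hw, hvw, hfw⟩ := hx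
            simp only [mem_biUnion, mem_filter, mem_image]
            exact ⟨i, hi, w, ⟨hw, hvw, hfw ▸ ((memC S f).1 hf).1 w hw⟩, f, ⟨hf, hfw⟩, rfl⟩
          refine (card_le_card hsub).trans (card_biUnion_le.trans (sum_le_sum fun i _ => ?_))
          exact card_biUnion_le.trans (sum_le_sum fun w _ => card_image_le)
      have hsum : l * ∑ i ∈ L v, ∑ w ∈ S with G.Adj v w ∧ i ∈ L w,
          ((C S).filter fun f => f w = i).card ≤ l * (D * (2 * (C S).card)) := by
        rw [mul_sum, ← hL v hvU]
        refine (sum_le_card_nsmul _ _ (D * (2 * (C S).card)) fun i hi => ?_).trans_eq (by simp)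
        rw [hL v hvU, mul_sum]
        refine (sum_le_card_nsmul _ _ (2 * (C S).card) fun w hw => ?_).trans ?_
        · exact hfix w (mem_filter.1 hw).1 i
        · rw [smul_eq_mul]
          refine Nat.mul_le_mul_right _ (le_trans (card_le_card ?_) (hdeg v hvU i hi))
          exact filter_subset_filter _ hSU
      have hsum' := Nat.le_of_mul_le_mul_left hsum hl
      rw [card_product, hL v hvU] at hcover
      nlinarith [Nat.mul_le_mul_right (C S).card hlD]
  have pos : ∀ S : Finset V, S ⊆ U → 0 < (C S).card := by
    intro S
    induction S using Finset.induction_on with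
    | empty =>
      intro _
      exact card_pos.2 ⟨fun _ => 0, by rw [memC]; simp⟩
    | insert a S ha ih =>
      intro hS
      have h1 := ih fun y hy => hS (mem_insert_of_mem hy)
      have h2 := key _ S rfl (fun y hy => hS (mem_insert_of_mem hy)) a (hS (mem_insert_self _ _)) ha
      have := Nat.mul_pos hl h1
      omega
  obtain ⟨f, hf⟩ := card_pos.1 (pos U subset_rfl)
  rw [memC] at hf
  exact ⟨f, hf.1, hf.2.2⟩

/-! ### The partition function on a set of vertices -/

section PartitionFunction

variable {V : Type*} (G : SimpleGraph V)

/-- The independent sets of `G` contained in `S`. -/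
noncomputable def indepSubsets (S : Finset V) : Finset (Finset V) :=
  S.powerset.filter fun A => G.IsIndepSet (A : Set V)

theorem mem_indepSubsets {S A : Finset V} :
    A ∈ indepSubsets G S ↔ A ⊆ S ∧ G.IsIndepSet (A : Set V) := by
  simp [indepSubsets]

theorem empty_mem_indepSubsets (S : Finset V) : ∅ ∈ indepSubsets G S := by
  simp [mem_indepSubsets, SimpleGraph.IsIndepSet]

/-- The partition function of a graph on `S` that has the same edges as `G` there, as a sum over
sets of vertices of `G`. -/
theorem partitionFunction_eq_sum (S : Finset V) (H : SimpleGraph (S : Set V))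
    (hH : ∀ a b, H.Adj a b ↔ G.Adj a b) (x : ℝ) :
    partitionFunction H x = ∑ A ∈ indepSubsets G S, x ^ A.card := by
  unfold partitionFunction
  refine sum_nbij' (fun I => I.map (Function.Embedding.subtype _))
    (fun A => A.subtype fun a => a ∈ (S : Set V)) ?_ ?_ ?_ ?_ ?_
  · intro I hI
    simp only [Set.Finite.mem_toFinset, Set.mem_ofPred_eq] at hI
    rw [mem_indepSubsets]
    refine ⟨fun a ha => ?_, ?_⟩
    · obtain ⟨b, _, rfl⟩ := mem_map.1 ha
      exact b.2
    · intro a ha b hb hab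
      obtain ⟨a', ha', rfl⟩ := mem_map.1 (mem_coe.1 ha)
      obtain ⟨b', hb', rfl⟩ := mem_map.1 (mem_coe.1 hb)
      exact fun hab' => hI ha' hb' (fun h => hab (by rw [h])) ((hH a' b').2 hab')
  · intro A hA
    rw [mem_indepSubsets] at hA
    simp only [Set.Finite.mem_toFinset, Set.mem_ofPred_eq]
    intro a ha b hb hab hab'
    exact hA.2 (mem_subtype.1 (mem_coe.1 ha)) (mem_subtype.1 (mem_coe.1 hb))
      (fun h => hab (Subtype.ext h)) ((hH a b).1 hab')
  · intro I _
    ext a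
    simp
  · intro A hA
    rw [mem_indepSubsets] at hA
    exact subtype_map_of_mem fun a ha => hA.1 ha
  · intro I _
    rw [card_map]

theorem partitionFunction_induce (S : Finset V) (x : ℝ) :
    partitionFunction (G.induce (S : Set V)) x = ∑ A ∈ indepSubsets G S, x ^ A.card :=
  partitionFunction_eq_sum G S _ (fun _ _ => Iff.rfl) x

theorem mul_deriv_partitionFunction_induce (S : Finset V) (x : ℝ) :
    x * deriv (partitionFunction (G.induce (S : Set V))) x =
      ∑ A ∈ indepSubsets G S, (A.card : ℝ) * x ^ A.card := by
  have h : partitionFunction (G.induce (S : Set V)) =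
      fun y => ∑ A ∈ indepSubsets G S, y ^ A.card :=
    funext fun y => partitionFunction_induce G S y
  rw [h, deriv_fun_sum fun A _ => by fun_prop, mul_sum]
  refine sum_congr rfl fun A _ => ?_
  rw [deriv_pow_field]
  rcases Nat.eq_zero_or_pos A.card with h0 | h0
  · simp [h0]
  · conv_rhs => rw [← Nat.sub_add_cancel h0, pow_succ]
    rw [Nat.sub_add_cancel h0]
    ring

theorem one_le_sum_indepSubsets (S : Finset V) {x : ℝ} (hx : 0 ≤ x) :
    1 ≤ ∑ A ∈ indepSubsets G S, x ^ A.card := by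
  have := single_le_sum (f := fun A : Finset V => x ^ A.card)
    (fun A _ => pow_nonneg hx _) (empty_mem_indepSubsets G S)
  simpa using this

theorem sum_indepSubsets_mono {S T : Finset V} (hST : S ⊆ T) {x : ℝ} (hx : 0 ≤ x) :
    ∑ A ∈ indepSubsets G S, x ^ A.card ≤ ∑ A ∈ indepSubsets G T, x ^ A.card := by
  refine sum_le_sum_of_subset_of_nonneg (fun A hA => ?_) fun A _ _ => pow_nonneg hx _
  rw [mem_indepSubsets] at hA ⊢
  exact ⟨hA.1.trans hST, hA.2⟩

/-- Local occupancy with the denominators cleared. -/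
theorem HasLocalOccupancy.sum_le [Finite V] {lam β γ : ℝ} (hlam : 0 < lam)
    (hocc : HasLocalOccupancy G lam β γ) (u : V) (S : Finset V) (hS : ∀ w ∈ S, G.Adj u w) :
    ∑ A ∈ indepSubsets G S, lam ^ A.card ≤
      β * (lam / (1 + lam)) + γ * ∑ A ∈ indepSubsets G S, (A.card : ℝ) * lam ^ A.card := by
  have h := hocc u (S : Set V) fun w hw => hS w hw
  rw [mul_deriv_partitionFunction_induce, partitionFunction_induce] at h
  have hZ : 0 < ∑ A ∈ indepSubsets G S, lam ^ A.card :=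
    zero_lt_one.trans_le (one_le_sum_indepSubsets G S hlam.le)
  set Z := ∑ A ∈ indepSubsets G S, lam ^ A.card
  set Y := ∑ A ∈ indepSubsets G S, (A.card : ℝ) * lam ^ A.card
  have h2 := mul_le_mul_of_nonneg_right h hZ.le
  have h3 : (β * (lam / (1 + lam)) * (1 / Z) + γ * (Y / Z)) * Z =
      β * (lam / (1 + lam)) + γ * Y := by
    field_simp
  linarith

end PartitionFunction

/-! ### Partial list colourings -/

section PartialColorings

variable {V : Type*} [Fintype V] (G : SimpleGraph V) (L : V → Finset ℕ)

/-- The proper partial colourings of `G` from the lists `L`; the value `none` stands for an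
uncoloured vertex. These are the independent sets of the cover graph. -/
noncomputable def partialColorings : Finset (V → Option ℕ) :=
  (Fintype.piFinset fun v => (L v).insertNone).filter fun c =>
    ∀ v w, G.Adj v w → ∀ i, c v = some i → c w ≠ some i

theorem mem_partialColorings {c : V → Option ℕ} :
    c ∈ partialColorings G L ↔ (∀ v i, c v = some i → i ∈ L v) ∧
      ∀ v w, G.Adj v w → ∀ i, c v = some i → c w ≠ some i := by
  simp only [partialColorings, mem_filter, Fintype.mem_piFinset, mem_insertNone, Option.mem_def]

/-- The hard-core weight of a partial colouring. -/
noncomputable def weight (lam : ℝ) (c : V → Option ℕ) : ℝ :=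
  lam ^ (univ.filter fun v => c v ≠ none).card

/-- The colours of the list of `v` that no neighbour of `v` has. -/
noncomputable def available (c : V → Option ℕ) (v : V) : Finset ℕ :=
  (L v).filter fun i => ∀ w, G.Adj v w → c w ≠ some i

/-- The uncoloured neighbours of `v` for which colour `i` is available. -/
noncomputable def freeNeighbors (c : V → Option ℕ) (v : V) (i : ℕ) : Finset V :=
  univ.filter fun w => G.Adj v w ∧ c w = none ∧ i ∈ available G L c w

/-- Give colour `i` to every vertex of `A`. -/
noncomputable def paint (c : V → Option ℕ) (A : Finset V) (i : ℕ) : V → Option ℕ :=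
  fun w => if w ∈ A then some i else c w

/-- Uncolour the neighbours of `v` that have colour `i`. -/
noncomputable def strip (c : V → Option ℕ) (v : V) (i : ℕ) : V → Option ℕ :=
  fun w => if G.Adj v w ∧ c w = some i then none else c w

/-- A set of proper partial colourings whose membership does not depend on the colours of the
neighbours of `v`. -/
structure IsLocalClass (v : V) (C : Finset (V → Option ℕ)) : Prop where
  subset : C ⊆ partialColorings G L
  mem_of_eq : ∀ c ∈ C, ∀ c' ∈ partialColorings G L, (∀ w, ¬ G.Adj v w → c' w = c w) → c' ∈ C

variable {G L}

theorem weight_pos {lam : ℝ} (hlam : 0 < lam) (c : V → Option ℕ) : 0 < weight lam c :=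
  pow_pos hlam _

theorem mem_available {c : V → Option ℕ} {v : V} {i : ℕ} :
    i ∈ available G L c v ↔ i ∈ L v ∧ ∀ w, G.Adj v w → c w ≠ some i := by
  simp [available]

theorem mem_freeNeighbors {c : V → Option ℕ} {v w : V} {i : ℕ} :
    w ∈ freeNeighbors G L c v i ↔ G.Adj v w ∧ c w = none ∧ i ∈ available G L c w := by
  simp [freeNeighbors]

theorem weight_paint {lam : ℝ} {c : V → Option ℕ} {A : Finset V} (hA : ∀ w ∈ A, c w = none)
    (i : ℕ) : weight lam (paint c A i) = weight lam c * lam ^ A.card := by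
  unfold weight
  rw [← pow_add, ← card_union_of_disjoint]
  · congr 2
    ext w
    rw [mem_union, mem_filter, mem_filter]
    by_cases hw : w ∈ A <;> simp [paint, hw]
  · rw [Finset.disjoint_left]
    intro w hw hwA
    exact (mem_filter.1 hw).2 (hA w hwA)

theorem paint_mem {r : V → Option ℕ} (hr : r ∈ partialColorings G L) {v : V} {i : ℕ} {A : Finset V}
    (hA : A ∈ indepSubsets G (freeNeighbors G L r v i)) : paint r A i ∈ partialColorings G L := by
  rw [mem_partialColorings] at hr ⊢
  rw [mem_indepSubsets] at hA
  have hf : ∀ w ∈ A, i ∈ L w ∧ ∀ x, G.Adj w x → r x ≠ some i := fun w hw =>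
    mem_available.1 (mem_freeNeighbors.1 (hA.1 hw)).2.2
  refine ⟨fun w j hj => ?_, fun w x hwx j hw hx => ?_⟩
  · by_cases hw : w ∈ A
    · simp only [paint, hw, if_true, Option.some.injEq] at hj
      exact hj ▸ (hf w hw).1
    · simp only [paint, hw, if_false] at hj
      exact hr.1 w j hj
  · by_cases hwA : w ∈ A <;> by_cases hxA : x ∈ A <;>
      simp only [paint, hwA, hxA, if_true, if_false, Option.some.injEq] at hw hx
    · exact hA.2 hwA hxA hwx.ne hwx
    · exact (hf w hwA).2 x hwx (by rw [hx, hw])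
    · exact (hf x hxA).2 w hwx.symm (by rw [hw, hx])
    · exact hr.2 w x hwx j hw hx

theorem strip_mem {c : V → Option ℕ} (hc : c ∈ partialColorings G L) (v : V) (i : ℕ) :
    strip G c v i ∈ partialColorings G L := by
  have hs : ∀ w j, strip G c v i w = some j → c w = some j := by
    intro w j h
    unfold strip at h
    split_ifs at h
    exact h
  rw [mem_partialColorings] at hc ⊢
  exact ⟨fun w j h => hc.1 w j (hs w j h), fun w x hwx j hw hx =>
    hc.2 w x hwx j (hs w j hw) (hs x j hx)⟩

/-- Resampling one colour around `v`: a class of partial colourings that is insensitive to the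
colours around `v` splits into parts, each of which arises from a partial colouring `r` without
colour `i` around `v` by giving colour `i` to an independent set of free neighbours of `v`. -/
theorem IsLocalClass.sum_eq {v : V} {C : Finset (V → Option ℕ)} (hC : IsLocalClass G L v C) (i : ℕ)
    (f : (V → Option ℕ) → ℝ) :
    ∑ c ∈ C, f c = ∑ r ∈ C with (∀ w, G.Adj v w → r w ≠ some i),
      ∑ A ∈ indepSubsets G (freeNeighbors G L r v i), f (paint r A i) := by
  have hstrip : ∀ c ∈ C, strip G c v i ∈ C.filter fun r => ∀ w, G.Adj v w → r w ≠ some i := by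
    intro c hc
    rw [mem_filter]
    refine ⟨hC.mem_of_eq c hc _ (strip_mem (hC.subset hc) v i) fun w hw => by simp [strip, hw],
      fun w hw => ?_⟩
    unfold strip
    split_ifs with h
    · simp
    · exact fun h' => h ⟨hw, h'⟩
  rw [← sum_fiberwise_of_maps_to hstrip]
  refine sum_congr rfl fun r hr => ?_
  rw [mem_filter] at hr
  refine sum_nbij' (fun c => univ.filter fun w => G.Adj v w ∧ c w = some i)
    (fun A => paint r A i) ?_ ?_ ?_ ?_ ?_
  · intro c hc
    obtain ⟨hcC, rfl⟩ := mem_filter.1 hc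
    have hc' := (mem_partialColorings G L).1 (hC.subset hcC)
    rw [mem_indepSubsets]
    refine ⟨fun w hw => ?_, fun w hw x hx _ hwx => ?_⟩
    · simp only [mem_filter, mem_univ, true_and] at hw
      rw [mem_freeNeighbors, mem_available]
      refine ⟨hw.1, by simp [strip, hw], hc'.1 w i hw.2, fun x hwx => ?_⟩
      unfold strip
      split_ifs
      · simp
      · exact hc'.2 w x hwx i hw.2
    · simp only [coe_filter, mem_univ, true_and, Set.mem_ofPred_eq] at hw hx
      exact hc'.2 w x hwx i hw.2 hx.2
  · intro A hA
    have hAf := (mem_indepSubsets G).1 hA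
    have hA' : ∀ w ∈ A, G.Adj v w ∧ r w = none := fun w hw =>
      ⟨(mem_freeNeighbors.1 (hAf.1 hw)).1, (mem_freeNeighbors.1 (hAf.1 hw)).2.1⟩
    rw [mem_filter]
    refine ⟨hC.mem_of_eq r hr.1 _ (paint_mem (hC.subset hr.1) hA) fun w hw => ?_, ?_⟩
    · have : w ∉ A := fun h => hw (hA' w h).1
      simp [paint, this]
    · funext w
      by_cases hw : w ∈ A
      · simp [strip, paint, hw, hA' w hw]
      · have := hr.2 w
        simp only [strip, paint, hw, if_false]
        rw [if_neg fun h => this h.1 h.2]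
  · intro c hc
    obtain ⟨hcC, rfl⟩ := mem_filter.1 hc
    funext w
    by_cases h : G.Adj v w ∧ c w = some i
    · simp [paint, h]
    · simp only [paint, strip, mem_filter, mem_univ, true_and, h, if_false]
  · intro A hA
    have hAf := (mem_indepSubsets G).1 hA
    ext w
    simp only [mem_filter, mem_univ, true_and]
    by_cases hw : w ∈ A
    · simp [paint, hw, (mem_freeNeighbors.1 (hAf.1 hw)).1]
    · simp only [paint, hw, if_false, iff_false, not_and]
      exact hr.2 w
  · intro c hc
    obtain ⟨hcC, rfl⟩ := mem_filter.1 hc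
    congr 1
    funext w
    by_cases h : G.Adj v w ∧ c w = some i
    · simp [paint, h]
    · simp only [paint, strip, mem_filter, mem_univ, true_and, h, if_false]

end PartialColorings

/-! ### The number of available colours -/

section Concentration

variable {V : Type*} [Fintype V] {G : SimpleGraph V} {L : V → Finset ℕ}

/-- The neighbours of `v` that have colour `i`. -/
noncomputable def coloredNeighbors (G : SimpleGraph V) (c : V → Option ℕ) (v : V) (i : ℕ) :
    Finset V :=
  univ.filter fun w => G.Adj v w ∧ c w = some i

theorem mem_coloredNeighbors {c : V → Option ℕ} {v w : V} {i : ℕ} :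
    w ∈ coloredNeighbors G c v i ↔ G.Adj v w ∧ c w = some i := by
  simp [coloredNeighbors]

theorem available_paint_erase {r : V → Option ℕ} {v : V} {i : ℕ} {A : Finset V}
    (hA : A ⊆ freeNeighbors G L r v i) :
    (available G L (paint r A i) v).erase i = (available G L r v).erase i := by
  ext j
  simp only [mem_erase, mem_available]
  refine and_congr_right fun hj => and_congr_right fun _ => forall_congr' fun w =>
    imp_congr_right fun _ => ?_
  by_cases hw : w ∈ A
  · have h1 := (mem_freeNeighbors.1 (hA hw)).2.1
    simp [paint, hw, h1, Ne.symm hj]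
  · simp [paint, hw]

theorem mem_available_paint {r : V → Option ℕ} {v : V} {i : ℕ} {A : Finset V} (hi : i ∈ L v)
    (hr : ∀ w, G.Adj v w → r w ≠ some i) (hA : A ⊆ freeNeighbors G L r v i) :
    i ∈ available G L (paint r A i) v ↔ A = ∅ := by
  rw [mem_available]
  refine ⟨fun h => ?_, fun h => ?_⟩
  · rw [eq_empty_iff_forall_notMem]
    intro w hw
    exact h.2 w (mem_freeNeighbors.1 (hA hw)).1 (by simp [paint, hw])
  · subst h
    exact ⟨hi, fun w hw => by simpa [paint] using hr w hw⟩

theorem weight_paint_of_mem {lam : ℝ} {r : V → Option ℕ} {v : V} {i : ℕ} {A : Finset V}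
    (hA : A ⊆ freeNeighbors G L r v i) :
    weight lam (paint r A i) = weight lam r * lam ^ A.card :=
  weight_paint (fun _ hw => (mem_freeNeighbors.1 (hA hw)).2.1) i

theorem coloredNeighbors_paint {r : V → Option ℕ} {v : V} {i : ℕ} {A : Finset V}
    (hr : ∀ w, G.Adj v w → r w ≠ some i) (hA : A ⊆ freeNeighbors G L r v i) :
    coloredNeighbors G (paint r A i) v i = A := by
  ext w
  rw [mem_coloredNeighbors]
  by_cases hw : w ∈ A
  · simp [paint, hw, (mem_freeNeighbors.1 (hA hw)).1]
  · have := hr w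
    simpa [paint, hw] using this

variable {lam β γ : ℝ}

/-- Local occupancy for a single colour `i`, averaged over a local class of partial colourings in
which the weight is tilted by `s` to the number of available colours at `v`. The tilt is harmless
as the colour `i` contributes a factor `s ≤ 1` when available and no factor otherwise. The exponent
`card - 1` occurs only where the set of available colours contains `i`, so that no truncation takes
place. -/
theorem IsLocalClass.sum_pow_le (hlam : 0 < lam) (hocc : HasLocalOccupancy G lam β γ) {v : V}
    {C : Finset (V → Option ℕ)} (hC : IsLocalClass G L v C) {i : ℕ} (hi : i ∈ L v) {s : ℝ}
    (hs0 : 0 ≤ s) (hs1 : s ≤ 1) :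
    ∑ c ∈ C, weight lam c * s ^ (available G L c v).card ≤
      ∑ c ∈ C, weight lam c * (β * (lam / (1 + lam)) *
          (if i ∈ available G L c v then s ^ ((available G L c v).card - 1) else 0) +
        γ * ((coloredNeighbors G c v i).card *
          s ^ (available G L c v).card)) := by
  rw [hC.sum_eq i, hC.sum_eq i]
  refine sum_le_sum fun r hr => ?_
  have hr' := (mem_filter.1 hr).2
  set k := ((available G L r v).erase i).card with hk
  set b := β * (lam / (1 + lam)) with hb
  set F := freeNeighbors G L r v i with hF
  have hcard : ∀ A ∈ indepSubsets G F, (available G L (paint r A i) v).card =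
      if A = ∅ then k + 1 else k := by
    intro A hA
    have hA := ((mem_indepSubsets G).1 hA).1
    rw [hk, ← available_paint_erase hA]
    split_ifs with h0
    · exact (card_erase_add_one ((mem_available_paint hi hr' hA).2 h0)).symm
    · rw [erase_eq_of_notMem fun h => h0 ((mem_available_paint hi hr' hA).1 h)]
  have hW : 0 ≤ weight lam r * s ^ k := mul_nonneg (weight_pos hlam r).le (pow_nonneg hs0 _)
  calc ∑ A ∈ indepSubsets G F,
        weight lam (paint r A i) * s ^ (available G L (paint r A i) v).card
      ≤ ∑ A ∈ indepSubsets G F, weight lam r * s ^ k * lam ^ A.card := by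
        refine sum_le_sum fun A hA => ?_
        rw [hcard A hA, weight_paint_of_mem ((mem_indepSubsets G).1 hA).1]
        have h1 : s ^ (if A = ∅ then k + 1 else k) ≤ s ^ k :=
          pow_le_pow_of_le_one hs0 hs1 (by split_ifs <;> omega)
        have h2 : 0 ≤ weight lam r * lam ^ A.card :=
          mul_nonneg (weight_pos hlam r).le (pow_nonneg hlam.le _)
        calc weight lam r * lam ^ A.card * s ^ (if A = ∅ then k + 1 else k)
            ≤ weight lam r * lam ^ A.card * s ^ k := mul_le_mul_of_nonneg_left h1 h2
          _ = _ := by ring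
    _ = weight lam r * s ^ k * ∑ A ∈ indepSubsets G F, lam ^ A.card := by rw [mul_sum]
    _ ≤ weight lam r * s ^ k *
          (b + γ * ∑ A ∈ indepSubsets G F, (A.card : ℝ) * lam ^ A.card) :=
        mul_le_mul_of_nonneg_left
          (HasLocalOccupancy.sum_le G hlam hocc v F fun w hw => (mem_freeNeighbors.1 hw).1) hW
    _ = weight lam r * s ^ k * ∑ A ∈ indepSubsets G F,
          ((if A = ∅ then b else 0) + γ * ((A.card : ℝ) * lam ^ A.card)) := by
        rw [sum_add_distrib, ← mul_sum, sum_ite_eq' _ _ (fun _ => b),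
          if_pos (empty_mem_indepSubsets G F)]
    _ = _ := by
        rw [mul_sum]
        refine sum_congr rfl fun A hA => ?_
        have hA' := ((mem_indepSubsets G).1 hA).1
        rw [coloredNeighbors_paint hr' hA', weight_paint_of_mem hA', hcard A hA]
        simp only [mem_available_paint hi hr' hA']
        by_cases h0 : A = ∅
        · subst h0
          simp
          ring
        · simp only [h0, if_false]
          ring

/-- Tilted local occupancy summed over the colours of the list of `v`. The neighbours of `v`
receive at most `Δ` colours altogether. -/
theorem IsLocalClass.mul_sum_pow_le [DecidableRel G.Adj] (hlam : 0 < lam) (hγ : 0 < γ)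
    (hocc : HasLocalOccupancy G lam β γ) {v : V}
    {C : Finset (V → Option ℕ)} (hC : IsLocalClass G L v C) {q : ℕ} (hq : (L v).card = q) {s : ℝ}
    (hs0 : 0 ≤ s) (hs1 : s ≤ 1) :
    (q - γ * G.maxDegree) * ∑ c ∈ C, weight lam c * s ^ (available G L c v).card ≤
      β * (lam / (1 + lam)) * ∑ c ∈ C, weight lam c *
        ((available G L c v).card * s ^ ((available G L c v).card - 1)) := by
  have h1 := sum_le_sum fun i (hi : i ∈ L v) => hC.sum_pow_le hlam hocc hi hs0 hs1
  rw [sum_const, hq, nsmul_eq_mul, sum_comm] at h1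
  have h2 : ∀ c ∈ C, ∑ i ∈ L v, weight lam c * (β * (lam / (1 + lam)) *
          (if i ∈ available G L c v then s ^ ((available G L c v).card - 1) else 0) +
        γ * ((coloredNeighbors G c v i).card *
          s ^ (available G L c v).card)) ≤
      β * (lam / (1 + lam)) * (weight lam c *
        ((available G L c v).card * s ^ ((available G L c v).card - 1))) +
      γ * G.maxDegree * (weight lam c * s ^ (available G L c v).card) := by
    intro c _
    rw [← mul_sum, sum_add_distrib, ← mul_sum, ← mul_sum, ← sum_mul, ← sum_filter]
    have h3 : (L v).filter (fun i => i ∈ available G L c v) = available G L c v := by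
      ext i
      rw [mem_filter]
      exact ⟨fun h => h.2, fun h => ⟨(mem_available.1 h).1, h⟩⟩
    rw [h3, sum_const, nsmul_eq_mul]
    have h4 : ∑ i ∈ L v, ((coloredNeighbors G c v i).card : ℝ) ≤
        G.maxDegree := by
      have h5 : ∑ i ∈ L v, (coloredNeighbors G c v i).card ≤ G.maxDegree := by
        rw [← card_biUnion]
        · refine (card_le_card ?_).trans (G.degree_le_maxDegree v)
          intro w hw
          simp only [mem_biUnion, mem_coloredNeighbors] at hw
          obtain ⟨i, _, hw, _⟩ := hw
          rwa [SimpleGraph.mem_neighborFinset]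
        · intro i _ j _ hij
          rw [Function.onFun, Finset.disjoint_left]
          intro w hw hw'
          rw [mem_coloredNeighbors] at hw hw'
          exact hij (Option.some.inj (hw.2.symm.trans hw'.2))
      exact_mod_cast h5
    have h6 : 0 ≤ weight lam c * (γ * s ^ (available G L c v).card) :=
      mul_nonneg (weight_pos hlam c).le (mul_nonneg hγ.le (pow_nonneg hs0 _))
    have h7 := mul_le_mul_of_nonneg_left h4 h6
    linarith
  have h8 := h1.trans (sum_le_sum h2)
  rw [sum_add_distrib, ← mul_sum, ← mul_sum] at h8
  linarith

/-- The exponential moment bound at `s = 1/2`, with the Poisson-like exponent `m (1 - s)`. Here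
`m` is the lower bound on the mean number of available colours given by local occupancy. -/
theorem IsLocalClass.sum_half_pow_le [DecidableRel G.Adj] (hlam : 0 < lam) (hβ : 0 < β)
    (hγ : 0 < γ) (hocc : HasLocalOccupancy G lam β γ) {v : V}
    {C : Finset (V → Option ℕ)} (hC : IsLocalClass G L v C) {q : ℕ} (hq : (L v).card = q) {m : ℝ}
    (hm : m ≤ (1 + lam) / (β * lam) * (q - γ * G.maxDegree)) :
    ∑ c ∈ C, weight lam c * (1 / 2) ^ (available G L c v).card ≤
      Real.exp (-m / 2) * ∑ c ∈ C, weight lam c := by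
  set M : ℝ → ℝ := fun s => ∑ c ∈ C, weight lam c * s ^ (available G L c v).card with hM
  set M' : ℝ → ℝ := fun s => ∑ c ∈ C, weight lam c *
        ((available G L c v).card * s ^ ((available G L c v).card - 1)) with hM'
  have hder : ∀ s, HasDerivAt M (M' s) s := by
    intro s
    exact HasDerivAt.fun_sum fun c _ => (hasDerivAt_pow _ s).const_mul _
  have hineq : ∀ s, 0 ≤ s → s ≤ 1 → m * M s ≤ M' s := by
    intro s h0 h1
    have h2 : (q - γ * G.maxDegree) * M s ≤ β * (lam / (1 + lam)) * M' s :=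
      hC.mul_sum_pow_le hlam hγ hocc hq h0 h1
    have hMs : 0 ≤ M s := sum_nonneg fun c _ => mul_nonneg (weight_pos hlam c).le (pow_nonneg h0 _)
    have hb : 0 < (1 + lam) / (β * lam) := by positivity
    calc m * M s ≤ (1 + lam) / (β * lam) * (q - γ * G.maxDegree) * M s :=
          mul_le_mul_of_nonneg_right hm hMs
      _ = (1 + lam) / (β * lam) * ((q - γ * G.maxDegree) * M s) := by ring
      _ ≤ (1 + lam) / (β * lam) * (β * (lam / (1 + lam)) * M' s) :=
          mul_le_mul_of_nonneg_left h2 hb.le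
      _ = M' s := by field_simp
  have hder' : ∀ s, HasDerivAt (fun s => Real.exp (-m * s) * M s)
      (Real.exp (-m * s) * (M' s - m * M s)) s := by
    intro s
    have h1 : HasDerivAt (fun s => Real.exp (-m * s)) (Real.exp (-m * s) * (-m)) s := by
      simpa using ((hasDerivAt_id s).const_mul (-m)).exp
    exact (h1.fun_mul (hder s)).congr_deriv (by ring)
  have hmono : MonotoneOn (fun s => Real.exp (-m * s) * M s) (Set.Icc 0 1) := by
    apply monotoneOn_of_deriv_nonneg (convex_Icc 0 1)
    · exact fun s _ => (hder' s).continuousAt.continuousWithinAt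
    · exact fun s _ => (hder' s).differentiableAt.differentiableWithinAt
    · intro s hs
      rw [interior_Icc] at hs
      rw [(hder' s).deriv]
      exact mul_nonneg (Real.exp_pos _).le (sub_nonneg.2 (hineq s hs.1.le hs.2.le))
  have h1 := hmono (a := 1 / 2) (b := 1) (by norm_num) (by norm_num) (by norm_num)
  have hM1 : M 1 = ∑ c ∈ C, weight lam c := by simp [hM]
  simp only [hM1] at h1
  have h2 := mul_le_mul_of_nonneg_left h1 (Real.exp_pos (m * (1 / 2))).le
  rw [← mul_assoc, ← mul_assoc, ← Real.exp_add, ← Real.exp_add] at h2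
  have h3 : m * (1 / 2) + -m * (1 / 2) = 0 := by ring
  have h4 : m * (1 / 2) + -m * 1 = -m / 2 := by ring
  rw [h3, h4, Real.exp_zero, one_mul] at h2
  exact h2

/-- Few available colours are unlikely. -/
theorem IsLocalClass.sum_card_available_lt_le [DecidableRel G.Adj] (hlam : 0 < lam) (hβ : 0 < β)
    (hγ : 0 < γ) (hocc : HasLocalOccupancy G lam β γ) {v : V}
    {C : Finset (V → Option ℕ)} (hC : IsLocalClass G L v C) {q : ℕ} (hq : (L v).card = q) {d : ℕ}
    (hm : 4 * Real.exp 1 * d ≤ (1 + lam) / (β * lam) * (q - γ * G.maxDegree)) :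
    ∑ c ∈ C with (available G L c v).card < 4 * d, weight lam c ≤
      Real.exp (-(Real.exp 1 * d / 2)) * ∑ c ∈ C, weight lam c := by
  have h1 : ∑ c ∈ C with (available G L c v).card < 4 * d, weight lam c ≤
      2 ^ (4 * d) * ∑ c ∈ C, weight lam c * (1 / 2) ^ (available G L c v).card := by
    rw [mul_sum, sum_filter]
    refine sum_le_sum fun c _ => ?_
    have hw := (weight_pos hlam c).le
    split_ifs with h
    · have h2 : (1 : ℝ) ≤ 2 ^ (4 * d) * (1 / 2) ^ (available G L c v).card := by
        rw [one_div, inv_pow, ← div_eq_mul_inv, one_le_div (by positivity)]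
        exact pow_le_pow_right₀ (by norm_num) h.le
      have := mul_le_mul_of_nonneg_left h2 hw
      linarith
    · positivity
  have hW : 0 ≤ ∑ c ∈ C, weight lam c := sum_nonneg fun c _ => (weight_pos hlam c).le
  have h2 : (2 : ℝ) ^ (4 * d) * Real.exp (-(4 * Real.exp 1 * d) / 2) ≤
      Real.exp (-(Real.exp 1 * d / 2)) := by
    -- `2 ^ 4 ≤ exp 3 ≤ exp (3 e / 2)`
    have he : (2.7182818283 : ℝ) < Real.exp 1 := Real.exp_one_gt_d9
    have h3 : (2 : ℝ) ^ 4 ≤ Real.exp (3 / 2 * Real.exp 1) := by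
      calc (2 : ℝ) ^ 4 ≤ Real.exp 1 ^ 3 := by
            calc (2 : ℝ) ^ 4 ≤ 2.7 ^ 3 := by norm_num
              _ ≤ Real.exp 1 ^ 3 := by gcongr; linarith
        _ = Real.exp 3 := by rw [← Real.exp_nat_mul]; norm_num
        _ ≤ _ := Real.exp_le_exp.2 (by linarith)
    calc (2 : ℝ) ^ (4 * d) * Real.exp (-(4 * Real.exp 1 * d) / 2)
        ≤ Real.exp (3 / 2 * Real.exp 1) ^ d * Real.exp (-(4 * Real.exp 1 * d) / 2) := by
          rw [pow_mul]; gcongr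
      _ = Real.exp (-(Real.exp 1 * d / 2)) := by
          rw [← Real.exp_nat_mul, ← Real.exp_add]; congr 1; ring
  calc _ ≤ _ := h1
    _ ≤ 2 ^ (4 * d) * (Real.exp (-(4 * Real.exp 1 * d) / 2) * ∑ c ∈ C, weight lam c) :=
        mul_le_mul_of_nonneg_left (hC.sum_half_pow_le hlam hβ hγ hocc hq hm) (by positivity)
    _ = 2 ^ (4 * d) * Real.exp (-(4 * Real.exp 1 * d) / 2) * ∑ c ∈ C, weight lam c := by ring
    _ ≤ _ := mul_le_mul_of_nonneg_right h2 hW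

/-- A colour is unlikely to be available at `v` while it is free at `d` neighbours of `v`. -/
theorem IsLocalClass.sum_freeNeighbors_le (hlam : 0 < lam) {v : V}
    {C : Finset (V → Option ℕ)} (hC : IsLocalClass G L v C) {d : ℕ} {p : ℝ}
    (hp : ∀ S : Finset V, (∀ w ∈ S, G.Adj v w) → S.card = d →
      1 ≤ p * ∑ A ∈ indepSubsets G S, lam ^ A.card) (hp0 : 0 ≤ p) {i : ℕ} (hi : i ∈ L v) :
    ∑ c ∈ C with i ∈ available G L c v ∧ d ≤ (freeNeighbors G L c v i).card, weight lam c ≤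
      p * ∑ c ∈ C, weight lam c := by
  rw [sum_filter, hC.sum_eq i, hC.sum_eq i, mul_sum]
  refine sum_le_sum fun r hr => ?_
  have hr' := (mem_filter.1 hr).2
  have hw := weight_pos hlam r
  have h1 : ∑ A ∈ indepSubsets G (freeNeighbors G L r v i), weight lam (paint r A i) =
      weight lam r * ∑ A ∈ indepSubsets G (freeNeighbors G L r v i), lam ^ A.card := by
    rw [mul_sum]
    exact sum_congr rfl fun A hA => weight_paint_of_mem ((mem_indepSubsets G).1 hA).1
  have h2 : ∑ A ∈ indepSubsets G (freeNeighbors G L r v i),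
      (if i ∈ available G L (paint r A i) v ∧ d ≤ (freeNeighbors G L (paint r A i) v i).card then
        weight lam (paint r A i) else 0) =
      if d ≤ (freeNeighbors G L r v i).card then weight lam r else 0 := by
    have h0 : paint r ∅ i = r := by funext w; simp [paint]
    rw [sum_eq_single_of_mem ∅ (empty_mem_indepSubsets G _)]
    · have h3 := (mem_available_paint (A := ∅) hi hr' (empty_subset _)).2 rfl
      rw [h0] at h3 ⊢
      simp [h3]
    · intro A hA hA0
      exact if_neg fun h =>
        hA0 ((mem_available_paint hi hr' ((mem_indepSubsets G).1 hA).1).1 h.1)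
  rw [h1, h2]
  split_ifs with hd
  · obtain ⟨S, hS, hSd⟩ := exists_subset_card_eq hd
    have h3 := hp S (fun w hw => (mem_freeNeighbors.1 (hS hw)).1) hSd
    have h4 := mul_le_mul_of_nonneg_left (sum_indepSubsets_mono G hS hlam.le) hp0
    have h5 := mul_le_mul_of_nonneg_left (h3.trans h4) hw.le
    linarith
  · exact mul_nonneg hp0 (mul_nonneg hw.le (sum_nonneg fun A _ => pow_nonneg hlam.le _))

end Concentration

/-! ### Bad vertices and their dependencies -/

section Bad

variable {V : Type*} [Fintype V] (G : SimpleGraph V) (L : V → Finset ℕ)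

/-- A vertex is bad if it has fewer than `4 * d` available colours, or if one of its available
colours is also available for at least `d` of its uncoloured neighbours. -/
def IsBad (d : ℕ) (v : V) (c : V → Option ℕ) : Prop :=
  (available G L c v).card < 4 * d ∨
    ∃ i ∈ available G L c v, d ≤ (freeNeighbors G L c v i).card

/-- The vertices `t` such that whether `t` is bad may depend on the colours of the neighbours of
`v`, together with `v` itself. They all are at distance at most three from `v`. -/
noncomputable def dependencyBall (v : V) : Finset V :=
  univ.filter fun t => t = v ∨ ∃ w, G.Adj v w ∧ (G.Adj t w ∨ ∃ x, G.Adj t x ∧ G.Adj x w)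

variable {G L}

theorem mem_dependencyBall {v t : V} : t ∈ dependencyBall G v ↔
    t = v ∨ ∃ w, G.Adj v w ∧ (G.Adj t w ∨ ∃ x, G.Adj t x ∧ G.Adj x w) := by
  simp [dependencyBall]

theorem available_congr {c c' : V → Option ℕ} {t : V} (h : ∀ w, G.Adj t w → c' w = c w) :
    available G L c' t = available G L c t := by
  ext i
  simp only [mem_available]
  exact and_congr_right fun _ => forall_congr' fun w => imp_congr_right fun hw => by rw [h w hw]

/-- Badness is determined by the colours at walks of length one and two. -/
theorem isBad_congr {d : ℕ} {c c' : V → Option ℕ} {t : V}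
    (h : ∀ w, (G.Adj t w ∨ ∃ x, G.Adj t x ∧ G.Adj x w) → c' w = c w) :
    IsBad G L d t c' ↔ IsBad G L d t c := by
  have h1 : available G L c' t = available G L c t := available_congr fun w hw => h w (Or.inl hw)
  have h2 : ∀ i, freeNeighbors G L c' t i = freeNeighbors G L c t i := by
    intro i
    ext x
    simp only [mem_freeNeighbors]
    refine and_congr_right fun hx => ?_
    rw [h x (Or.inl hx), available_congr fun w hw => h w (Or.inr ⟨x, hx, hw⟩)]
  simp only [IsBad, h1, h2]

theorem isLocalClass_filter_not_isBad {d : ℕ} {v : V} {T : Finset V}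
    (hT : Disjoint T (dependencyBall G v)) :
    IsLocalClass G L v ((partialColorings G L).filter fun c => ∀ t ∈ T, ¬ IsBad G L d t c) where
  subset := filter_subset _ _
  mem_of_eq := by
    intro c hc c' hc' heq
    rw [mem_filter] at hc ⊢
    refine ⟨hc', fun t ht hbad => hc.2 t ht ((isBad_congr fun w hw => heq w fun hvw => ?_).1 hbad)⟩
    exact Finset.disjoint_left.1 hT ht (mem_dependencyBall.2 (Or.inr ⟨w, hvw, hw⟩))

theorem card_dependencyBall_le [DecidableRel G.Adj] (hΔ : 2 ≤ G.maxDegree) (v : V) :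
    (dependencyBall G v).card ≤ G.maxDegree ^ 3 := by
  set Δ := G.maxDegree with hΔdef
  have hdeg : ∀ u, (G.neighborFinset u).card ≤ Δ := fun u => G.degree_le_maxDegree u
  have hdeg' : ∀ u w, G.Adj u w → ((G.neighborFinset u).erase w).card ≤ Δ - 1 := by
    intro u w huw
    rw [card_erase_of_mem ((G.mem_neighborFinset _ _).2 huw)]
    exact Nat.sub_le_sub_right (hdeg u) 1
  -- The endpoints of non-backtracking walks from `v` of length two and three.
  set S2 := (G.neighborFinset v).biUnion fun w => (G.neighborFinset w).erase v with hS2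
  set S3 := (G.neighborFinset v).biUnion fun w => ((G.neighborFinset w).erase v).biUnion fun x =>
    (G.neighborFinset x).erase w with hS3
  have hsub : dependencyBall G v ⊆ (({v} ∪ G.neighborFinset v) ∪ S2) ∪ S3 := by
    intro t ht
    rw [mem_dependencyBall] at ht
    simp only [hS2, hS3, mem_union, mem_singleton, mem_biUnion, mem_erase,
      SimpleGraph.mem_neighborFinset]
    by_cases htv : t = v
    · exact Or.inl (Or.inl (Or.inl htv))
    by_cases htN : G.Adj v t
    · exact Or.inl (Or.inl (Or.inr htN))
    rcases ht with ht | ⟨w, hvw, htw | ⟨x, htx, hxw⟩⟩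
    · exact absurd ht htv
    · exact Or.inl (Or.inr ⟨w, hvw, htv, htw.symm⟩)
    · refine Or.inr ⟨w, hvw, x, ⟨?_, hxw.symm⟩, ?_, htx.symm⟩
      · rintro rfl
        exact htN htx.symm
      · rintro rfl
        exact htN hvw
  have h2 : S2.card ≤ Δ * (Δ - 1) := by
    refine (card_biUnion_le_card_mul _ _ (Δ - 1) fun w hw => ?_).trans
      (Nat.mul_le_mul_right _ (hdeg v))
    exact hdeg' w v ((G.mem_neighborFinset _ _).1 hw).symm
  have h3 : S3.card ≤ Δ * ((Δ - 1) * (Δ - 1)) := by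
    refine (card_biUnion_le_card_mul _ _ ((Δ - 1) * (Δ - 1)) fun w hw => ?_).trans
      (Nat.mul_le_mul_right _ (hdeg v))
    refine (card_biUnion_le_card_mul _ _ (Δ - 1) fun x hx => ?_).trans
      (Nat.mul_le_mul_right _ (hdeg' w v ((G.mem_neighborFinset _ _).1 hw).symm))
    exact hdeg' x w ((G.mem_neighborFinset _ _).1 (mem_erase.1 hx).2).symm
  have h4 := (card_le_card hsub).trans ((card_union_le _ _).trans (Nat.add_le_add_right
    ((card_union_le _ _).trans (Nat.add_le_add_right (card_union_le _ _) _)) _))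
  rw [card_singleton] at h4
  have h5 := hdeg v
  obtain ⟨k, hk⟩ : ∃ k, Δ = k + 2 := ⟨Δ - 2, by omega⟩
  rw [hk] at h2 h3 h5 ⊢
  have hk1 : k + 2 - 1 = k + 1 := rfl
  rw [hk1] at h2 h3
  nlinarith

/-- The conditional probability that `v` is bad, given the colours away from `v`. -/
theorem IsLocalClass.sum_isBad_le [DecidableRel G.Adj] {lam β γ : ℝ} (hlam : 0 < lam) (hβ : 0 < β)
    (hγ : 0 < γ) (hocc : HasLocalOccupancy G lam β γ) {v : V}
    {C : Finset (V → Option ℕ)} (hC : IsLocalClass G L v C) {q : ℕ} (hq : (L v).card = q) {d : ℕ}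
    (hm : 4 * Real.exp 1 * d ≤ (1 + lam) / (β * lam) * (q - γ * G.maxDegree)) {p : ℝ}
    (hp0 : 0 ≤ p) (hp : ∀ S : Finset V, (∀ w ∈ S, G.Adj v w) → S.card = d →
      1 ≤ p * ∑ A ∈ indepSubsets G S, lam ^ A.card) :
    ∑ c ∈ C with IsBad G L d v c, weight lam c ≤
      (Real.exp (-(Real.exp 1 * d / 2)) + q * p) * ∑ c ∈ C, weight lam c := by
  have h1 := hC.sum_card_available_lt_le hlam hβ hγ hocc hq hm
  have h2 := sum_le_sum fun i (hi : i ∈ L v) => hC.sum_freeNeighbors_le hlam hp hp0 hi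
  rw [sum_const, hq, nsmul_eq_mul] at h2
  have h3 : ∑ c ∈ C with IsBad G L d v c, weight lam c ≤
      ∑ c ∈ C with (available G L c v).card < 4 * d, weight lam c +
      ∑ i ∈ L v, ∑ c ∈ C with i ∈ available G L c v ∧ d ≤ (freeNeighbors G L c v i).card,
        weight lam c := by
    simp only [sum_filter]
    rw [sum_comm, ← sum_add_distrib]
    refine sum_le_sum fun c _ => ?_
    have hw := (weight_pos hlam c).le
    have hnn : ∀ i ∈ L v, 0 ≤ if i ∈ available G L c v ∧ d ≤ (freeNeighbors G L c v i).card then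
        weight lam c else 0 := fun i _ => by split_ifs <;> [exact hw; exact le_rfl]
    have hnn' := sum_nonneg hnn
    by_cases hb : IsBad G L d v c
    · rw [if_pos hb]
      rcases hb with h | ⟨i, hi, h⟩
      · rw [if_pos h]
        exact le_add_of_nonneg_right hnn'
      · have h4 := single_le_sum hnn (mem_available.1 hi).1
        rw [if_pos ⟨hi, h⟩] at h4
        exact h4.trans (le_add_of_nonneg_left (by split_ifs <;> [exact hw; exact le_rfl]))
    · rw [if_neg hb]
      exact add_nonneg (by split_ifs <;> [exact hw; exact le_rfl]) hnn'
  linarith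

end Bad

/-! ### Colouring from the lists -/

section Main

variable {V : Type*} [Fintype V] {G : SimpleGraph V}

/-- A partial colouring without bad vertices extends to a list colouring. -/
theorem exists_list_coloring_of_forall_not_isBad {L : V → Finset ℕ} {d : ℕ} (hd : 0 < d)
    {c : V → Option ℕ} (hc : c ∈ partialColorings G L) (hbad : ∀ v, ¬ IsBad G L d v c) :
    ∃ f : V → ℕ, (∀ v, f v ∈ L v) ∧ ∀ v w, G.Adj v w → f v ≠ f w := by
  have hbad' : ∀ v, 4 * d ≤ (available G L c v).card ∧
      ∀ i ∈ available G L c v, (freeNeighbors G L c v i).card < d := by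
    intro v
    have := hbad v
    simp only [IsBad, not_or, not_lt, not_exists, not_and, not_le] at this
    exact this
  choose L' hL' hcard using fun v => exists_subset_card_eq (hbad' v).1
  rw [mem_partialColorings] at hc
  obtain ⟨g, hgL, hg⟩ := exists_list_coloring_of_colorDegree G L'
    (univ.filter fun v => c v = none) (4 * d) d (by omega) le_rfl (fun v _ => hcard v) (by
      intro v _ i hi
      refine (card_le_card fun w hw => ?_).trans ((hbad' v).2 i (hL' v hi)).le
      simp only [mem_filter, mem_univ, true_and] at hw
      exact mem_freeNeighbors.2 ⟨hw.2.1, hw.1, hL' w hw.2.2⟩)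
  have hgA : ∀ v, c v = none → g v ∈ available G L c v := fun v hv =>
    hL' v (hgL v (by simpa using hv))
  refine ⟨fun v => (c v).getD (g v), fun v => ?_, fun v w hvw => ?_⟩
  · rcases hcv : c v with _ | i
    · simpa [hcv] using (mem_available.1 (hgA v hcv)).1
    · simpa [hcv] using hc.1 v i hcv
  · change (c v).getD (g v) ≠ (c w).getD (g w)
    rcases hcv : c v with _ | i <;> rcases hcw : c w with _ | j
    · simpa using hg v (by simpa using hcv) w (by simpa using hcw) hvw
    · intro h
      refine (mem_available.1 (hgA v hcv)).2 w hvw ?_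
      simp only [Option.getD_none, Option.getD_some] at h
      rw [hcw, h]
    · intro h
      refine (mem_available.1 (hgA w hcw)).2 v hvw.symm ?_
      simp only [Option.getD_none, Option.getD_some] at h
      rw [hcv, h]
    · intro h
      simp only [Option.getD_some] at h
      exact hc.2 v w hvw i hcv (by rw [hcw, h])

/-- Every graph can be coloured from lists that are four times larger than its maximum degree. -/
theorem exists_list_coloring_of_maxDegree_mul_four_le [DecidableRel G.Adj] {L : V → Finset ℕ}
    {q : ℕ} (hq : 0 < q) (hΔ : 4 * G.maxDegree ≤ q) (hL : ∀ v, (L v).card = q) :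
    ∃ f : V → ℕ, (∀ v, f v ∈ L v) ∧ ∀ v w, G.Adj v w → f v ≠ f w := by
  obtain ⟨f, hf, hf'⟩ := exists_list_coloring_of_colorDegree G L univ q G.maxDegree hq hΔ
    (fun v _ => hL v) (by
      intro v _ i _
      refine (card_le_card fun w hw => ?_).trans (G.degree_le_maxDegree v)
      simp only [mem_filter] at hw
      exact (G.mem_neighborFinset _ _).2 hw.2.1)
  exact ⟨f, fun v => hf v (mem_univ v), fun v w => hf' v (mem_univ v) w (mem_univ w)⟩

variable {lam β γ : ℝ}

/-- The list colouring statement for graphs of maximum degree at least two. -/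
theorem exists_list_coloring_of_two_le_maxDegree [DecidableRel G.Adj] (hlam : 0 < lam)
    (hβ : 0 < β) (hγ : 0 < γ) (hocc : HasLocalOccupancy G lam β γ) {q d : ℕ} (hq : 0 < q)
    (hΔ : 2 ≤ G.maxDegree)
    (hd : (2 / Real.exp 1) * Real.log (2 * Real.exp 1 * (G.maxDegree : ℝ) ^ 3) ≤ (d : ℝ))
    (hm : 4 * Real.exp 1 * d ≤ (1 + lam) / (β * lam) * (q - γ * G.maxDegree))
    (hZ : ∀ v, ∀ S : Finset V, (∀ w ∈ S, G.Adj v w) → S.card = d →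
      1 ≤ 1 / (2 * Real.exp 1 * q * (G.maxDegree : ℝ) ^ 3) *
        ∑ A ∈ indepSubsets G S, lam ^ A.card)
    {L : V → Finset ℕ} (hL : ∀ v, (L v).card = q) :
    ∃ f : V → ℕ, (∀ v, f v ∈ L v) ∧ ∀ v w, G.Adj v w → f v ≠ f w := by
  have he : 1 < Real.exp 1 := Real.one_lt_exp_iff.2 one_pos
  have hΔR : (2 : ℝ) ≤ G.maxDegree := by exact_mod_cast hΔ
  have hΔ3 : (1 : ℝ) ≤ (G.maxDegree : ℝ) ^ 3 := one_le_pow₀ (by linarith)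
  have hqR : (0 : ℝ) < q := by exact_mod_cast hq
  have harg : 1 < 2 * Real.exp 1 * (G.maxDegree : ℝ) ^ 3 := by nlinarith
  have hd0 : 0 < d := by
    have : 0 < (2 / Real.exp 1) * Real.log (2 * Real.exp 1 * (G.maxDegree : ℝ) ^ 3) :=
      mul_pos (by positivity) (Real.log_pos harg)
    exact_mod_cast this.trans_le hd
  have hexp : Real.exp (-(Real.exp 1 * d / 2)) ≤
      1 / (2 * Real.exp 1 * (G.maxDegree : ℝ) ^ 3) := by
    have h1 : Real.log (2 * Real.exp 1 * (G.maxDegree : ℝ) ^ 3) ≤ Real.exp 1 * d / 2 := by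
      have h2 := mul_le_mul_of_nonneg_left hd (show 0 ≤ Real.exp 1 / 2 by positivity)
      have h3 : Real.exp 1 / 2 * (2 / Real.exp 1 *
          Real.log (2 * Real.exp 1 * (G.maxDegree : ℝ) ^ 3)) =
          Real.log (2 * Real.exp 1 * (G.maxDegree : ℝ) ^ 3) := by field_simp
      linarith
    rw [Real.exp_neg, ← one_div]
    exact one_div_le_one_div_of_le (by linarith) ((Real.log_le_iff_le_exp (by linarith)).1 h1)
  obtain ⟨n, hn⟩ : ∃ n, G.maxDegree ^ 3 = n + 1 :=
    ⟨G.maxDegree ^ 3 - 1, (Nat.sub_add_cancel (Nat.one_le_pow _ _ (by omega))).symm⟩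
  have hnR : (G.maxDegree : ℝ) ^ 3 = n + 1 := by exact_mod_cast hn
  have hn1 : 1 < (n : ℝ) + 1 := by
    rw [← hnR]
    exact one_lt_pow₀ (by linarith) (by norm_num)
  have hlt : 1 / ((n : ℝ) + 1) < 1 := by
    rw [div_lt_one (by linarith)]
    exact hn1
  have hpos : 0 < ∑ c ∈ partialColorings G L, weight lam c := by
    refine sum_pos (fun c _ => weight_pos hlam c) ⟨fun _ => none, ?_⟩
    rw [mem_partialColorings]
    simp
  obtain ⟨c, hc, hbad⟩ := exists_avoiding_of_lopsided (partialColorings G L) (weight lam)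
    (fun c _ => (weight_pos hlam c).le) hpos (IsBad G L d) (dependencyBall G)
    (1 / (Real.exp 1 * ((n : ℝ) + 1))) (1 / ((n : ℝ) + 1)) n (by positivity) hlt
    (inv_exp_mul_le n) (fun v => mem_dependencyBall.2 (Or.inl rfl))
    (fun v => (card_dependencyBall_le hΔ v).trans_eq hn) (by
      intro v T hT
      rw [← filter_filter]
      refine ((isLocalClass_filter_not_isBad hT).sum_isBad_le hlam hβ hγ hocc (hL v) hm
        (by positivity) (hZ v)).trans ?_
      refine mul_le_mul_of_nonneg_right ?_ (sum_nonneg fun c _ => (weight_pos hlam c).le)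
      rw [← hnR]
      have h1 : (q : ℝ) * (1 / (2 * Real.exp 1 * q * (G.maxDegree : ℝ) ^ 3)) =
          1 / (2 * Real.exp 1 * (G.maxDegree : ℝ) ^ 3) := by field_simp
      have h2 : 1 / (Real.exp 1 * (G.maxDegree : ℝ) ^ 3) =
          1 / (2 * Real.exp 1 * (G.maxDegree : ℝ) ^ 3) +
          1 / (2 * Real.exp 1 * (G.maxDegree : ℝ) ^ 3) := by field_simp; norm_num
      rw [h1, h2]
      linarith)
  exact exists_list_coloring_of_forall_not_isBad hd0 hc hbad

/-- In a graph of maximum degree one the lists have at least four colours: local occupancy on the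
empty graph bounds `β * lam / (1 + lam)` from below. -/
theorem four_le_of_maxDegree_eq_one [DecidableRel G.Adj] (hlam : 0 < lam)
    (hβ : 0 < β) (hγ : 0 < γ) (hocc : HasLocalOccupancy G lam β γ) {q d : ℕ}
    (hΔ : G.maxDegree = 1)
    (hd : (2 / Real.exp 1) * Real.log (2 * Real.exp 1 * (G.maxDegree : ℝ) ^ 3) ≤ (d : ℝ))
    (hm : 4 * Real.exp 1 * d ≤ (1 + lam) / (β * lam) * (q - γ * G.maxDegree)) : 4 ≤ q := by
  have hV : Nonempty V := by
    by_contra h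
    rw [not_nonempty_iff] at h
    rw [SimpleGraph.maxDegree_of_subsingleton] at hΔ
    exact zero_ne_one hΔ
  obtain ⟨u⟩ := hV
  have he : 1 < Real.exp 1 := Real.one_lt_exp_iff.2 one_pos
  have hb := HasLocalOccupancy.sum_le G hlam hocc u ∅ (by simp)
  have h0 : indepSubsets G ∅ = {∅} := by
    ext A
    rw [mem_indepSubsets, mem_singleton, subset_empty]
    exact ⟨fun h => h.1, fun h => ⟨h, by simp [h, SimpleGraph.IsIndepSet]⟩⟩
  simp only [h0, sum_singleton, card_empty, pow_zero, Nat.cast_zero, zero_mul, mul_zero,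
    add_zero] at hb
  rw [hΔ] at hd hm
  have hd1 : (1 : ℝ) ≤ d := by
    have : 0 < (2 / Real.exp 1) * Real.log (2 * Real.exp 1 * ((1 : ℕ) : ℝ) ^ 3) :=
      mul_pos (by positivity) (Real.log_pos (by norm_num; linarith))
    exact_mod_cast this.trans_le hd
  have h1 := mul_le_mul_of_nonneg_left hm (show 0 ≤ β * (lam / (1 + lam)) by positivity)
  have h2 : β * (lam / (1 + lam)) * ((1 + lam) / (β * lam) * (q - γ * ((1 : ℕ) : ℝ))) =
      q - γ := by
    field_simp
    norm_num
  have h3 : 4 ≤ 4 * Real.exp 1 * d := by nlinarith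
  have h4 : 4 * Real.exp 1 * d ≤ β * (lam / (1 + lam)) * (4 * Real.exp 1 * d) :=
    le_mul_of_one_le_left (by linarith) hb
  have h5 : (4 : ℝ) ≤ q := by linarith
  exact_mod_cast h5

end Main

end LocalOccupancy

theorem mainTheorem2 {V : Type*} [Fintype V] (G : SimpleGraph V) [DecidableRel G.Adj]
    (lam β γ : ℝ) (hlam : 0 < lam) (hβ : 0 < β) (hγ : 0 < γ)
    (hocc : LocalOccupancy.HasLocalOccupancy G lam β γ)
    (q : ℕ) (hq : 0 < q) (d : ℕ)
    (hd : (2 / Real.exp 1) * Real.log (2 * Real.exp 1 * (G.maxDegree : ℝ) ^ 3) ≤ (d : ℝ))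
    (hlist : 4 * Real.exp 1 * (d : ℝ) ≤
      (1 + lam) / (β * lam) * ((q : ℝ) - γ * (G.maxDegree : ℝ)))
    (hdeg : ∀ u : V, ∀ F : G.Subgraph, F.verts ⊆ G.neighborSet u → F.verts.ncard = d →
      1 / LocalOccupancy.partitionFunction F.coe lam ≤
        1 / (2 * Real.exp 1 * (q : ℝ) * (G.maxDegree : ℝ) ^ 3)) :
    G.chromaticNumber ≤ (q : ℕ∞) ∧
      LocalOccupancy.listChromaticNumber G ≤ (q : ℕ∞) ∧
      ∀ L : V → Finset ℕ, (∀ v, (L v).card = q) →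
        ∃ I : Finset {x : V × ℕ // x.2 ∈ L x.1},
          (LocalOccupancy.coverGraph G L).IsIndepSet (I : Set {x : V × ℕ // x.2 ∈ L x.1}) ∧
            I.card = Fintype.card V := by
  have main : ∀ L : V → Finset ℕ, (∀ v, (L v).card = q) →
      ∃ f : V → ℕ, (∀ v, f v ∈ L v) ∧ ∀ v w, G.Adj v w → f v ≠ f w := by
    intro L hL
    rcases Nat.lt_or_ge 1 G.maxDegree with hΔ | hΔ
    · refine LocalOccupancy.exists_list_coloring_of_two_le_maxDegree hlam hβ hγ hocc hq hΔ hd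
        hlist ?_ hL
      intro v S hS hSd
      have h1 := hdeg v ((⊤ : G.Subgraph).induce (S : Set V)) (fun w hw => hS w hw)
        (by rw [SimpleGraph.Subgraph.induce_verts, Set.ncard_coe_finset, hSd])
      have h2 := LocalOccupancy.partitionFunction_eq_sum G S
        ((⊤ : G.Subgraph).induce (S : Set V)).coe
        (fun a b => ⟨fun h => h.2.2, fun h => ⟨a.2, b.2, h⟩⟩) lam
      have h3 : 0 < ∑ A ∈ LocalOccupancy.indepSubsets G S, lam ^ A.card :=
        zero_lt_one.trans_le (LocalOccupancy.one_le_sum_indepSubsets G S hlam.le)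
      exact (div_le_iff₀ h3).1 ((congrArg (fun z => 1 / z) h2).ge.trans h1)
    · refine LocalOccupancy.exists_list_coloring_of_maxDegree_mul_four_le hq ?_ hL
      rcases Nat.eq_zero_or_pos G.maxDegree with h0 | h0
      · omega
      · have h1 : G.maxDegree = 1 := by omega
        have := LocalOccupancy.four_le_of_maxDegree_eq_one hlam hβ hγ hocc h1 hd hlist
        omega
  have hch : LocalOccupancy.Choosable G q := by
    intro L hL
    obtain ⟨f, hf, hf'⟩ := main L hL
    exact ⟨SimpleGraph.Coloring.mk f fun {v w} h => hf' v w h, hf⟩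
  refine ⟨?_, iInf₂_le q hch, ?_⟩
  · obtain ⟨f, hf, hf'⟩ := main (fun _ => Finset.range q) (by simp)
    refine SimpleGraph.Colorable.chromaticNumber_le
      ⟨SimpleGraph.Coloring.mk (fun v => (⟨f v, Finset.mem_range.1 (hf v)⟩ : Fin q)) ?_⟩
    intro v w h h'
    exact hf' v w h (congrArg Fin.val h')
  · intro L hL
    obtain ⟨f, hf, hf'⟩ := main L hL
    have hinj : Function.Injective
        fun v => (⟨(v, f v), hf v⟩ : {x : V × ℕ // x.2 ∈ L x.1}) := fun v w h =>
      congrArg (fun x => x.1.1) h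
    refine ⟨Finset.univ.map ⟨_, hinj⟩, ?_, by simp⟩
    intro x hx y hy _ hadj
    simp only [Finset.coe_map, Function.Embedding.coeFn_mk, Finset.coe_univ, Set.image_univ,
      Set.mem_range] at hx hy
    obtain ⟨v, rfl⟩ := hx
    obtain ⟨w, rfl⟩ := hy
    rcases hadj with ⟨h1, h2⟩ | ⟨h1, h2⟩
    · exact h2 (congrArg f h1)
    · exact hf' v w h1 h2
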